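/- **The calculus $\lambda^+$.** Types are $R,S::=\tau\mid R\Rightarrow S\mid R\wedge S$ with one atomic type $\tau$; $\equiv$ is the congruence generated by $R\wedge S\equiv S\wedge R$, $(R\wedge S)\wedge T\equiv R\wedge(S\wedge T)$, $R\Rightarrow(S\wedge T)\equiv(R\Rightarrow S)\wedge(R\Rightarrow T)$, $R\Rightarrow S\Rightarrow T\equiv(R\wedge S)\Rightarrow T$. Terms, up to $\alpha$-equivalence, are $r,s::=x^R\mid\lambda x^R.r\mid rs\mid r+s\mid\pi_R(r)$. Typing $\Gamma\vdash r:R$ has the usual rules for variables, abstraction and application; if $r:R$ and $R\equiv R'$ then $r:R'$; if $r:R$ and $s:S$ then $r+s:R\wedge S$; if $r:R\wedge R'$ or $r:R$ then $\pi_R(r):R$. The relation $\rightleftarrows$ is symmetric, closed under term contexts, and generated by (comm) $r+s\rightleftarrows s+r$; (asso) $(r+s)+t\rightleftarrows r+(s+t)$; (dist$_{ii}$) $\lambda x^R.(r+s)\rightleftarrows\lambda x^R.r+\lambda x^R.s$; (dist$_{ie}$) $(r+s)t\rightleftarrows rt+st$; (dist$_{ei}$) $\pi_{R\Rightarrow S}(\lambda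 x^R.r)\rightleftarrows\lambda x^R.\pi_S(r)$; (dist$_{ee}$) $\pi_{R\Rightarrow S}(r)s\rightleftarrows\pi_S(rs)$ if $r:R\Rightarrow(S\wedge T)$ and $s:R$; (curry) $rst\rightleftarrows r(s+t)$; (subst) $r\rightleftarrows r\{S/R\}$ (all occurrences of the type $R$ replaced by $S$) if $R\equiv S$; (split) $\pi_{R\wedge S}(r+s)\rightleftarrows\pi_R(r)+\pi_S(s)$ if $r$ has type $R\wedge R'$ or $R$, and $s$ has type $S\wedge S'$ or $S$. (comm) and (asso) are the AC rules. The reduction $\hookrightarrow$ is generated by ($\beta$) $(\lambda x^R.r)s\hookrightarrow r\{s/x\}$ if $s:R$; ($\pi_n$) $\pi_R(r+s)\hookrightarrow r$ if $r:R$; ($\pi_1$) $\pi_R(r)\hookrightarrow r$ if $r:R$; ($\delta$) $r\hookrightarrow\pi_R(r)+\pi_S(r)$ if $r:R\wedge S$ and there are no $s:R$, $t:S$ with $r\rightleftarrows^*s+t$. The first three are closed under all contexts, ($\delta$) under the contexts $C[\cdot]$ for which no $C'$, $R$ satisfy $C[\cdot]\rightleftarrows^*C'[\pi_R(\cdot)]$.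 **The implementation.** Canonical types $C,D$ are nonempty finite multisets $[C_i\Rightarrow\tau]_{i=1}^n$, each $C_i$ being a canonical type or empty ($[\,]\Rightarrow\tau$ is $\tau$). $\mathrm{can}(\tau)=[\tau]$, $\mathrm{can}(R\wedge S)=\mathrm{can}(R)\uplus\mathrm{can}(S)$, and $\mathrm{can}(R\Rightarrow S)=[\mathrm{can}(R)\uplus D_i\Rightarrow\tau]_i$ where $\mathrm{can}(S)=[D_i\Rightarrow\tau]_i$. The terms of the implementation are $x^C\mid\lambda x^C.r\mid rs\mid[r_1,\dots,r_n]\mid\pi_C(r)$, where $[r_1,\dots,r_n]$ ($n\ge1$) is a multiset, nested multisets are flattened and $[r]=r$. $\mathrm{can}(r)$ replaces each type annotation $R$ of $r$ by $\mathrm{can}(R)$ and each $s+t$ by $[s,t]$. Typing: $\Gamma,x^C\vdash x:C$; if $\Gamma,x^C\vdash r:[D_i\Rightarrow\tau]_i$ then $\Gamma\vdash\lambda x^C.r:[C\uplus D_i\Rightarrow\tau]_i$; if $r:[C_k\Rightarrow\tau]_k$, $s:D$ and $D\subseteq C_k$ for all $k$ then $rs:[C_k\setminus D\Rightarrow\tau]_k$;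 if $r_i:C_i$ for all $i$ then $[r_1,\dots,r_n]:C_1\uplus\dots\uplus C_n$; if $r:C$ and $\emptyset\ne D\subseteq C$ then $\pi_D(r):D$. (Inclusion, union and difference respect multiplicities.) The rewrite relation $\to$ is generated by ($\beta$) $(\lambda x^C.r)s\to r\{s/x\}$ if $s:C$; (p$\beta$) $(\lambda x^C.r)s\to\lambda y^{C\setminus D}.r\{[s,y]/x\}$ if $s:D$ and $D\subsetneq C$; (d$\beta$) $(\lambda x^C.r)s\to\lambda x^C.(rs)$ if $s:D$ and $D\cap C=\emptyset$; (curry) $r[s_1,\dots,s_n]\to rs_1\cdots s_n$ for $n\ge2$; (dist$_i$) $[r_1,\dots,r_n]s\to[r_1s,\dots,r_ns]$ for $n\ge2$; (comm$_{ei}$) $\pi_{[C_k\Rightarrow\tau]_k}(\lambda x^D.r)\to\lambda x^D.\pi_{[C_k\setminus D\Rightarrow\tau]_k}(r)$ if $D\subseteq C_k$ for all $k$; (comm$_{ee}$) $\pi_{[C_i\Rightarrow\tau]_i}(rs)\to\pi_{[D\uplus C_i\Rightarrow\tau]_i}(r)s$ if $s:D$; (proj) $\pi_C(r)\to r$ if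 $r:C$; (simp) $\pi_C([r,s])\to\pi_C(r)$ if $r:D$ and $C\subseteq D$; (dist$_e$) $\pi_{C\uplus D}([r,s])\to[\pi_C(r),\pi_D(s)]$ if $r:C'$, $s:D'$, $\emptyset\ne C\subseteq C'$ and $\emptyset\ne D\subseteq D'$; ($\delta$) $r\to[\pi_{C_1}(r),\dots,\pi_{C_n}(r)]$ if $n\ge2$, $r:C_1\uplus\dots\uplus C_n$ with canonical types $C_i$, and $r$ is not of the form $[r_1,\dots,r_n]$ with $r_i:C_i$ for all $i$. All rules except ($\delta$) are closed under all contexts, ($\delta$) under the contexts that are not of the form $C'[\pi_C(\cdot)]$. Two terms are joinable if they have a common reduct under $\to^*$. **Theorem.** Let $r$ be a closed $\lambda^+$ term. 1. Suppose $r$ is typable and $r\rightleftarrows r'$ by any rule other than (comm) and (asso). - If $\vdash r:R\Rightarrow S$, then for every term $s$ of the implementation with $\vdash s:\mathrm{can}(R)$, the terms $\mathrm{can}(r)\,s$ and $\mathrm{can}(r')\,s$ are joinable. - If $r$ has no type of the form $R\Rightarrow S$, then $\mathrm{can}(r)$ and $\mathrm{can}(r')$ are joinable. 2. If $r\hookrightarrow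 r'$, then $\mathrm{can}(r)\to^+\mathrm{can}(r')$. -/

import Mathlib

namespace LamPlus

/-! Terms of both calculi share one grammar and differ in the type annotations `A`. Terms are taken
up to renaming of bound variables, by de Bruijn indices: `var n` points to the `n`-th enclosing
binder, or beyond the binders to the typing context. -/

/-- `x`, `λ x^a. t`, `r s`, `r + s`, `π_a (t)`. -/
inductive Tm (A : Type) : Type
  | var (n : ℕ) : Tm A
  | lam (a : A) (t : Tm A) : Tm A
  | app (r s : Tm A) : Tm A
  | plus (r s : Tm A) : Tm A
  | proj (a : A) (t : Tm A) : Tm A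

namespace Tm

variable {A B : Type}

/-- Apply `f` to every type annotation. -/
def map (f : A → B) : Tm A → Tm B
  | var n => var n
  | lam a t => lam (f a) (map f t)
  | app r s => app (map f r) (map f s)
  | plus r s => plus (map f r) (map f s)
  | proj a t => proj (f a) (map f t)

def upr (f : ℕ → ℕ) : ℕ → ℕ
  | 0 => 0
  | n + 1 => f n + 1

def rename (f : ℕ → ℕ) : Tm A → Tm A
  | var n => var (f n)
  | lam a t => lam a (rename (upr f) t)
  | app r s => app (rename f r) (rename f s)
  | plus r s => plus (rename f r) (rename f s)
  | proj a t => proj a (rename f t)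

/-- Weakening: `t` seen under one more binder. -/
def shift (t : Tm A) : Tm A := rename Nat.succ t

def up (σ : ℕ → Tm A) : ℕ → Tm A
  | 0 => var 0
  | n + 1 => shift (σ n)

/-- Simultaneous capture-avoiding substitution. -/
def subst (σ : ℕ → Tm A) : Tm A → Tm A
  | var n => σ n
  | lam a t => lam a (subst (up σ) t)
  | app r s => app (subst σ r) (subst σ s)
  | plus r s => plus (subst σ r) (subst σ s)
  | proj a t => proj a (subst σ t)

def instVar (s : Tm A) : ℕ → Tm A
  | 0 => s
  | n + 1 => var n

/-- `r{s/x}`, where `x` is the variable `0` of `r`. -/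
def inst (r s : Tm A) : Tm A := subst (instVar s) r

def pinstVar (s : Tm A) : ℕ → Tm A
  | 0 => plus (shift s) (var 0)
  | n + 1 => var (n + 1)

/-- `r{[s, y]/x}`, where `x` is the variable `0` of `r` and `y` the variable `0` of the result
(`s` does not contain `y`). -/
def pinst (r s : Tm A) : Tm A := subst (pinstVar s) r

/-- All free variables are among the first `n` indices. -/
def Scoped : ℕ → Tm A → Prop
  | n, var i => i < n
  | n, lam _ t => Scoped (n + 1) t
  | n, app r s => Scoped n r ∧ Scoped n s
  | n, plus r s => Scoped n r ∧ Scoped n s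
  | n, proj _ t => Scoped n t

def Closed (t : Tm A) : Prop := Scoped 0 t

/-- `r + r₁ + ⋯ + rₙ`, associated to the left. -/
def sum (r : Tm A) (rs : List (Tm A)) : Tm A := rs.foldl plus r

/-- `r s₁ ⋯ sₙ`. -/
def apps (r : Tm A) (ss : List (Tm A)) : Tm A := ss.foldl app r

/-- Equality of terms up to associativity and commutativity of `+`: the congruence generated by
these two laws. -/
inductive AC : Tm A → Tm A → Prop
  | refl (r : Tm A) : AC r r
  | symm {r s : Tm A} : AC r s → AC s r
  | trans {r s t : Tm A} : AC r s → AC s t → AC r t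
  | comm (r s : Tm A) : AC (plus r s) (plus s r)
  | assoc (r s t : Tm A) : AC (plus (plus r s) t) (plus r (plus s t))
  | lam (a : A) {r s : Tm A} : AC r s → AC (lam a r) (lam a s)
  | app {r r' s s' : Tm A} : AC r r' → AC s s' → AC (app r s) (app r' s')
  | plus {r r' s s' : Tm A} : AC r r' → AC s s' → AC (plus r s) (plus r' s')
  | proj (a : A) {r s : Tm A} : AC r s → AC (proj a r) (proj a s)

end Tm

/-- Term contexts `C[·]`. -/
inductive Cx (A : Type) : Type
  | hole : Cx A
  | lam (a : A) (C : Cx A) : Cx A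
  | appL (C : Cx A) (r : Tm A) : Cx A
  | appR (r : Tm A) (C : Cx A) : Cx A
  | plusL (C : Cx A) (r : Tm A) : Cx A
  | plusR (r : Tm A) (C : Cx A) : Cx A
  | proj (a : A) (C : Cx A) : Cx A

namespace Cx

variable {A : Type}

/-- `C[t]`; the binders of `C` capture. -/
def plug : Cx A → Tm A → Tm A
  | hole, t => t
  | lam a C, t => Tm.lam a (plug C t)
  | appL C r, t => Tm.app (plug C t) r
  | appR r C, t => Tm.app r (plug C t)
  | plusL C r, t => Tm.plus (plug C t) r
  | plusR r C, t => Tm.plus r (plug C t)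
  | proj a C, t => Tm.proj a (plug C t)

/-- The context `C[D[·]]`. -/
def comp : Cx A → Cx A → Cx A
  | hole, D => D
  | lam a C, D => lam a (comp C D)
  | appL C r, D => appL (comp C D) r
  | appR r C, D => appR r (comp C D)
  | plusL C r, D => plusL (comp C D) r
  | plusR r C, D => plusR r (comp C D)
  | proj a C, D => proj a (comp C D)

/-- The typing context at the hole of `C`, when `C` itself stands in the typing context `Γ`. -/
def binders : Cx A → List A → List A
  | hole, Γ => Γ
  | lam a C, Γ => binders C (a :: Γ)
  | appL C _, Γ => binders C Γ
  | appR _ C, Γ => binders C Γ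
  | plusL C _, Γ => binders C Γ
  | plusR _ C, Γ => binders C Γ
  | proj _ C, Γ => binders C Γ

/-- `C` with its hole filled by the variable that has index `n` outside `C` (never captured). -/
def fill : Cx A → ℕ → Tm A
  | hole, n => Tm.var n
  | lam a C, n => Tm.lam a (fill C (n + 1))
  | appL C r, n => Tm.app (fill C n) r
  | appR r C, n => Tm.app r (fill C n)
  | plusL C r, n => Tm.plus (fill C n) r
  | plusR r C, n => Tm.plus r (fill C n)
  | proj a C, n => Tm.proj a (fill C n)

/-- All free variables of the context are among the first `n` indices. -/
def Scoped : ℕ → Cx A → Prop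
  | _, hole => True
  | n, lam _ C => Scoped (n + 1) C
  | n, appL C r => Scoped n C ∧ Tm.Scoped n r
  | n, appR r C => Tm.Scoped n r ∧ Scoped n C
  | n, plusL C r => Scoped n C ∧ Tm.Scoped n r
  | n, plusR r C => Tm.Scoped n r ∧ Scoped n C
  | n, proj _ C => Scoped n C

/-- `C[·] = C'[π_a(·)]` for some `C'` and `a`. -/
def InProj (C : Cx A) : Prop := ∃ (C' : Cx A) (a : A), C = comp C' (proj a hole)

end Cx

/-- The two labels of reduction steps: `¬δ` and `δ`. -/
inductive Lab : Type
  | notDelta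
  | delta

/-! ### The calculus λ⁺ -/

/-- Types: `τ`, `R ⇒ S`, `R ∧ S`. -/
inductive Ty : Type
  | atom : Ty
  | arr (R S : Ty) : Ty
  | conj (R S : Ty) : Ty
  deriving DecidableEq

namespace Ty

/-- The congruence `≡` generated by the four isomorphisms. -/
inductive Iso : Ty → Ty → Prop
  | refl (R : Ty) : Iso R R
  | symm {R S : Ty} : Iso R S → Iso S R
  | trans {R S T : Ty} : Iso R S → Iso S T → Iso R T
  | comm (R S : Ty) : Iso (conj R S) (conj S R)
  | assoc (R S T : Ty) : Iso (conj (conj R S) T) (conj R (conj S T))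
  | dist (R S T : Ty) : Iso (arr R (conj S T)) (conj (arr R S) (arr R T))
  | curry (R S T : Ty) : Iso (arr R (arr S T)) (arr (conj R S) T)
  | arr {R R' S S' : Ty} : Iso R R' → Iso S S' → Iso (arr R S) (arr R' S')
  | conj {R R' S S' : Ty} : Iso R R' → Iso S S' → Iso (conj R S) (conj R' S')

/-- `T{S/R}`: all occurrences of the type `R` in `T` are replaced by `S`. -/
def replace (R S : Ty) : Ty → Ty
  | atom => if atom = R then S else atom
  | arr T U => if arr T U = R then S else arr (replace R S T) (replace R S U)
  | conj T U => if conj T U = R then S else conj (replace R S T) (replace R S U)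

end Ty

open Tm in
/-- Typing judgements `Γ ⊢ r : R` of λ⁺. -/
inductive Typed : List Ty → Tm Ty → Ty → Prop
  | ax {Γ : List Ty} {n : ℕ} {R : Ty} : Γ[n]? = some R → Typed Γ (var n) R
  | iso {Γ : List Ty} {r : Tm Ty} {R R' : Ty} : Ty.Iso R R' → Typed Γ r R → Typed Γ r R'
  | arrI {Γ : List Ty} {r : Tm Ty} {R S : Ty} :
      Typed (S :: Γ) r R → Typed Γ (lam S r) (Ty.arr S R)
  | arrE {Γ : List Ty} {r s : Tm Ty} {R S : Ty} :
      Typed Γ r (Ty.arr S R) → Typed Γ s S → Typed Γ (app r s) R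
  | conjI {Γ : List Ty} {r s : Tm Ty} {R S : Ty} :
      Typed Γ r R → Typed Γ s S → Typed Γ (plus r s) (Ty.conj R S)
  | conjEn {Γ : List Ty} {r : Tm Ty} {R R' : Ty} :
      Typed Γ r (Ty.conj R R') → Typed Γ (proj R r) R
  | conjE1 {Γ : List Ty} {r : Tm Ty} {R : Ty} : Typed Γ r R → Typed Γ (proj R r) R

/-- Names of the rules of the symmetric relation `⇄`. -/
inductive EqRule : Type
  | comm | asso | distII | distIE | distEI | distEE | curry | subst | split

open Tm in
/-- The axioms of `⇄`, from left to right. -/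
inductive EqAx : EqRule → List Ty → Tm Ty → Tm Ty → Prop
  | comm (Γ : List Ty) (r s : Tm Ty) : EqAx .comm Γ (plus r s) (plus s r)
  | asso (Γ : List Ty) (r s t : Tm Ty) :
      EqAx .asso Γ (plus (plus r s) t) (plus r (plus s t))
  | distII (Γ : List Ty) (R : Ty) (r s : Tm Ty) :
      EqAx .distII Γ (lam R (plus r s)) (plus (lam R r) (lam R s))
  | distIE (Γ : List Ty) (r s t : Tm Ty) :
      EqAx .distIE Γ (app (plus r s) t) (plus (app r t) (app s t))
  | distEI (Γ : List Ty) (R S : Ty) (r : Tm Ty) :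
      EqAx .distEI Γ (proj (Ty.arr R S) (lam R r)) (lam R (proj S r))
  | distEE {Γ : List Ty} {R S T : Ty} {r s : Tm Ty} :
      Typed Γ r (Ty.arr R (Ty.conj S T)) → Typed Γ s R →
      EqAx .distEE Γ (app (proj (Ty.arr R S) r) s) (proj S (app r s))
  | curry (Γ : List Ty) (r s t : Tm Ty) :
      EqAx .curry Γ (app (app r s) t) (app r (plus s t))
  | subst (Γ : List Ty) {R S : Ty} (r : Tm Ty) :
      Ty.Iso R S → EqAx .subst Γ r (Tm.map (Ty.replace R S) r)
  | split {Γ : List Ty} {R R' S S' : Ty} {r s : Tm Ty} :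
      (Typed Γ r (Ty.conj R R') ∨ Typed Γ r R) → (Typed Γ s (Ty.conj S S') ∨ Typed Γ s S) →
      EqAx .split Γ (proj (Ty.conj R S) (plus r s)) (plus (proj R r) (proj S s))

/-- `r ⇄ s` by the rule `ρ`, between terms over the typing context `Γ`. -/
inductive Eqv (ρ : EqRule) : List Ty → Tm Ty → Tm Ty → Prop
  | ax {Γ : List Ty} {r s : Tm Ty} : EqAx ρ Γ r s → Eqv ρ Γ r s
  | symm {Γ : List Ty} {r s : Tm Ty} : Eqv ρ Γ r s → Eqv ρ Γ s r
  | ctx {Γ : List Ty} (C : Cx Ty) {r s : Tm Ty} :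
      Eqv ρ (C.binders Γ) r s → Eqv ρ Γ (C.plug r) (C.plug s)

/-- `r ⇄* s`. -/
def EqvStar (Γ : List Ty) : Tm Ty → Tm Ty → Prop :=
  Relation.ReflTransGen (fun r s => ∃ ρ, Eqv ρ Γ r s)

/-- `C[·] ⇄ D[·]` for contexts over `Γ` whose hole has type `T`: the hole is treated as a fresh
variable, the last one of the typing context `Γ ++ [T]`. -/
def CxEqv (Γ : List Ty) (T : Ty) (C D : Cx Ty) : Prop :=
  C.Scoped Γ.length ∧ D.Scoped Γ.length ∧
    ∃ ρ, Eqv ρ (Γ ++ [T]) (C.fill Γ.length) (D.fill Γ.length)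

/-- `C[·] ⇄* C'[π_R(·)]` for some `C'` and `R`, where the hole has the type of `r`. -/
def Blocked (Γ : List Ty) (C : Cx Ty) (r : Tm Ty) : Prop :=
  ∃ (T : Ty) (D : Cx Ty), Typed (C.binders Γ) r T ∧
    Relation.ReflTransGen (CxEqv Γ T) C D ∧ D.InProj

open Tm in
/-- The axioms of the reduction `↪`. -/
inductive RedAx : Lab → List Ty → Tm Ty → Tm Ty → Prop
  | beta {Γ : List Ty} {R : Ty} {s : Tm Ty} (r : Tm Ty) :
      Typed Γ s R → RedAx .notDelta Γ (app (lam R r) s) (inst r s)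
  | projN {Γ : List Ty} {R : Ty} {r : Tm Ty} (s : Tm Ty) :
      Typed Γ r R → RedAx .notDelta Γ (proj R (plus r s)) r
  | proj1 {Γ : List Ty} {R : Ty} {r : Tm Ty} :
      Typed Γ r R → RedAx .notDelta Γ (proj R r) r
  | delta {Γ : List Ty} {R S : Ty} {r : Tm Ty} :
      Typed Γ r (Ty.conj R S) →
      (¬ ∃ s t : Tm Ty, EqvStar Γ r (plus s t) ∧ Typed Γ s R ∧ Typed Γ t S) →
      RedAx .delta Γ r (plus (proj R r) (proj S r))

/-- Labelled reduction of λ⁺. -/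
inductive RedL : Lab → List Ty → Tm Ty → Tm Ty → Prop
  | ax {ℓ : Lab} {Γ : List Ty} {r s : Tm Ty} : RedAx ℓ Γ r s → RedL ℓ Γ r s
  | ctxNotDelta {Γ : List Ty} (C : Cx Ty) {r s : Tm Ty} :
      RedL .notDelta (C.binders Γ) r s → RedL .notDelta Γ (C.plug r) (C.plug s)
  | ctxDelta {Γ : List Ty} (C : Cx Ty) {r s : Tm Ty} :
      RedL .delta (C.binders Γ) r s → ¬ Blocked Γ C r → RedL .delta Γ (C.plug r) (C.plug s)

/-- `r ↪ s`. -/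
def Red (Γ : List Ty) (r s : Tm Ty) : Prop := ∃ ℓ, RedL ℓ Γ r s

/-! ### Canonical types

A canonical type is a nonempty multiset `[C₁ ⇒ τ, …, Cₙ ⇒ τ]`, where each `Cᵢ` is a canonical type
or empty (`[] ⇒ τ` being `τ`). Its elements form the least fixed point of the multiset functor. -/

noncomputable instance : QPF Multiset where
  P := ⟨ℕ, Fin⟩
  abs p := ↑(List.ofFn p.2)
  repr s := ⟨s.toList.length, s.toList.get⟩
  abs_repr s := by
    change (↑(List.ofFn s.toList.get) : Multiset _) = s
    rw [List.ofFn_get, Multiset.coe_toList]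
  abs_map f p := by
    change (↑(List.ofFn (f ∘ p.2)) : Multiset _) = Multiset.map f ↑(List.ofFn p.2)
    rw [Multiset.map_coe, List.map_ofFn]

/-- The types `C ⇒ τ`. -/
def Prime : Type := QPF.Fix Multiset

namespace Prime

/-- `C ⇒ τ`. -/
noncomputable def mk (C : Multiset Prime) : Prime := QPF.Fix.mk C

/-- The multiset `C` in `C ⇒ τ`. -/
noncomputable def args (p : Prime) : Multiset Prime := QPF.Fix.dest p

theorem args_mk (C : Multiset Prime) : args (mk C) = C := QPF.Fix.dest_mk C

theorem mk_args (p : Prime) : mk (args p) = p := QPF.Fix.mk_dest p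

noncomputable instance : DecidableEq Prime := Classical.decEq Prime

/-- `(C ⊎ D) ⇒ τ`, from `D ⇒ τ`. -/
noncomputable def addArgs (C : Multiset Prime) (p : Prime) : Prime := mk (C + args p)

/-- `(D \ C) ⇒ τ`, from `D ⇒ τ`. -/
noncomputable def subArgs (C : Multiset Prime) (p : Prime) : Prime := mk (args p - C)

end Prime

/-- Multisets of types `C ⇒ τ`; the canonical types are the nonempty ones. Inclusion, union and
difference of multisets (with multiplicities) are `≤`, `+` and `-`. -/
abbrev CTy : Type := Multiset Prime

/-- The canonical form of a type. -/
noncomputable def can : Ty → CTy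
  | .atom => {Prime.mk 0}
  | .arr R S => (can S).map (Prime.addArgs (can R))
  | .conj R S => can R + can S

/-! ### The implementation

Its terms are built like those of λ⁺, with canonical types and with multisets `[r₁, …, rₙ]` (where
`[r] = r` and nested multisets are flattened) instead of sums: that is, they are terms up to
associativity and commutativity of `+`. Typing and the rewrite axioms are stated on
representatives. -/

/-- The canonical form of a term. -/
noncomputable def canTm (r : Tm Ty) : Tm CTy := r.map can

instance ACSetoid : Setoid (Tm CTy) := ⟨Tm.AC, ⟨Tm.AC.refl, Tm.AC.symm, Tm.AC.trans⟩⟩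

/-- Terms of the implementation. -/
def ITm : Type := Quotient ACSetoid

def ITm.of (r : Tm CTy) : ITm := Quotient.mk ACSetoid r

open Tm in
/-- Typing in the implementation. -/
inductive ITyped : List CTy → Tm CTy → CTy → Prop
  | ax {Γ : List CTy} {n : ℕ} {C : CTy} : Γ[n]? = some C → ITyped Γ (var n) C
  | arrI {Γ : List CTy} {r : Tm CTy} {C D : CTy} :
      C ≠ 0 → ITyped (C :: Γ) r D → ITyped Γ (lam C r) (D.map (Prime.addArgs C))
  | arrE {Γ : List CTy} {r s : Tm CTy} {C D : CTy} :
      ITyped Γ r C → ITyped Γ s D → (∀ p ∈ C, D ≤ p.args) →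
      ITyped Γ (app r s) (C.map (Prime.subArgs D))
  | conjI {Γ : List CTy} {r s : Tm CTy} {C D : CTy} :
      ITyped Γ r C → ITyped Γ s D → ITyped Γ (plus r s) (C + D)
  | conjE {Γ : List CTy} {r : Tm CTy} {C D : CTy} :
      ITyped Γ r C → D ≠ 0 → D ≤ C → ITyped Γ (proj D r) D

open Tm in
/-- The rewrite axioms of the implementation. -/
inductive IAx : Lab → List CTy → Tm CTy → Tm CTy → Prop
  | beta {Γ : List CTy} {C : CTy} {s : Tm CTy} (r : Tm CTy) :
      ITyped Γ s C → IAx .notDelta Γ (app (lam C r) s) (inst r s)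
  | pbeta {Γ : List CTy} {C D : CTy} {s : Tm CTy} (r : Tm CTy) :
      ITyped Γ s D → D < C → IAx .notDelta Γ (app (lam C r) s) (lam (C - D) (pinst r s))
  | dbeta {Γ : List CTy} {C D : CTy} {s : Tm CTy} (r : Tm CTy) :
      ITyped Γ s D → D ∩ C = 0 →
      IAx .notDelta Γ (app (lam C r) s) (lam C (app r (shift s)))
  | curry (Γ : List CTy) (r s : Tm CTy) (ss : List (Tm CTy)) :
      ss ≠ [] → IAx .notDelta Γ (app r (sum s ss)) (apps r (s :: ss))
  | distI (Γ : List CTy) (r : Tm CTy) (rs : List (Tm CTy)) (s : Tm CTy) :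
      rs ≠ [] →
      IAx .notDelta Γ (app (sum r rs) s) (sum (app r s) (rs.map fun r' => app r' s))
  | commEI (Γ : List CTy) {C D : CTy} (r : Tm CTy) :
      (∀ p ∈ C, D ≤ p.args) →
      IAx .notDelta Γ (proj C (lam D r)) (lam D (proj (C.map (Prime.subArgs D)) r))
  | commEE {Γ : List CTy} {C D : CTy} {s : Tm CTy} (r : Tm CTy) :
      ITyped Γ s D →
      IAx .notDelta Γ (proj C (app r s)) (app (proj (C.map (Prime.addArgs D)) r) s)
  | proj {Γ : List CTy} {C : CTy} {r : Tm CTy} :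
      ITyped Γ r C → IAx .notDelta Γ (proj C r) r
  | simp {Γ : List CTy} {C D : CTy} {r : Tm CTy} (s : Tm CTy) :
      ITyped Γ r D → C ≤ D → IAx .notDelta Γ (proj C (plus r s)) (proj C r)
  | distE {Γ : List CTy} {C C' D D' : CTy} {r s : Tm CTy} :
      C ≠ 0 → D ≠ 0 → ITyped Γ r C' → ITyped Γ s D' → C ≤ C' → D ≤ D' →
      IAx .notDelta Γ (proj (C + D) (plus r s)) (plus (proj C r) (proj D s))
  | delta {Γ : List CTy} {C : CTy} {Cs : List CTy} {r : Tm CTy} :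
      Cs ≠ [] → (∀ D ∈ C :: Cs, D ≠ 0) → ITyped Γ r (C :: Cs).sum →
      (¬ ∃ (u : Tm CTy) (us : List (Tm CTy)),
        Tm.AC r (sum u us) ∧ List.Forall₂ (ITyped Γ) (u :: us) (C :: Cs)) →
      IAx .delta Γ r (sum (proj C r) (Cs.map fun D => Tm.proj D r))

/-- Labelled rewriting of the implementation, on representatives. -/
inductive IStepL : Lab → List CTy → Tm CTy → Tm CTy → Prop
  | ax {ℓ : Lab} {Γ : List CTy} {r s : Tm CTy} : IAx ℓ Γ r s → IStepL ℓ Γ r s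
  | ctxNotDelta {Γ : List CTy} (C : Cx CTy) {r s : Tm CTy} :
      IStepL .notDelta (C.binders Γ) r s → IStepL .notDelta Γ (C.plug r) (C.plug s)
  | ctxDelta {Γ : List CTy} (C : Cx CTy) {r s : Tm CTy} :
      IStepL .delta (C.binders Γ) r s → ¬ C.InProj → IStepL .delta Γ (C.plug r) (C.plug s)
  | ac {ℓ : Lab} {Γ : List CTy} {r r' s s' : Tm CTy} :
      Tm.AC r r' → IStepL ℓ Γ r' s' → Tm.AC s' s → IStepL ℓ Γ r s

/-- The rewrite relation `→` of the implementation, over the typing context `Γ`. -/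
def IStep (Γ : List CTy) (x y : ITm) : Prop :=
  ∃ (ℓ : Lab) (r s : Tm CTy), x = ITm.of r ∧ y = ITm.of s ∧ IStepL ℓ Γ r s

/-- Joinability under `→`, for closed terms. -/
def Joinable (x y : ITm) : Prop :=
  ∃ t : ITm, Relation.ReflTransGen (IStep []) x t ∧ Relation.ReflTransGen (IStep []) y t

end LamPlus

/-!
The map `can` on types is a complete invariant: isomorphic types have the same canonical form
(`can_eq_of_iso`), types with the same canonical form are isomorphic (`iso_of_can_eq`), and every
nonempty multiset of primes is the canonical form of a type (`exists_can_eq`). Hence the translation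
of terms preserves and reflects typing (`ITyped.canTm_of_typed`, `ITyped.typed`).

*The relation `⇄`.* Every rule other than (comm), (asso) and (distII) becomes an equality or one
step of the implementation, in one of the two directions and under any context (`EqAx.iRwN_or`).
For (distII) one has to join `K[λx.(a + b)]` and `K[λx.a + λx.b]` for a typed context `K`. If (δ) is
allowed at the hole of `K`, it expands the first term to a sum of two projections of `λx.(a + b)`,
which reduce to `λx.a` and `λx.b` (`iRw_lam_plus`). Otherwise `K` is `K'[π(·)]`. Then the projection
moves inwards in both terms and either selects from a single summand, which makes the terms equal,
or splits, which leaves `K'[λx.(π a + π b)]` and `K'[λx.π a + λx.π b]`, an instance of the same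
problem with a smaller context (`exists_iRw_iRw_lam_plus`). So the translations of two related
typable terms are always joinable, whether or not the terms have an arrow type, and joinability is
inherited by their applications to a common argument.

*The reduction `↪`.* Each rule without (δ) becomes one or two steps. For (δ), the implementation asks
that the translated term be no sum of terms of the expected types up to AC. Equality up to AC does
not look at annotations, so that such a sum would come from one in λ⁺ (`Tm.AC.lift_map`), whose
parts have the expected types because typing is reflected. A redex of (δ) is typable, so its context
is blocked as soon as its hole stands directly under a projection (`RedL.exists_ax`).
-/

namespace LamPlus

/-! ### Canonical types -/

namespace Prime

@[simp] theorem args_addArgs (C : CTy) (p : Prime) : (addArgs C p).args = C + p.args :=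
  args_mk _

@[simp] theorem subArgs_addArgs (C : CTy) (p : Prime) : subArgs C (addArgs C p) = p := by
  rw [subArgs, args_addArgs, add_tsub_cancel_left, mk_args]

theorem addArgs_subArgs {C : CTy} {p : Prime} (h : C ≤ p.args) :
    addArgs C (subArgs C p) = p := by
  rw [addArgs, subArgs, args_mk, add_tsub_cancel_of_le h, mk_args]

theorem addArgs_addArgs (C D : CTy) (p : Prime) :
    addArgs C (addArgs D p) = addArgs (C + D) p := by
  rw [addArgs, args_addArgs, addArgs, add_assoc]

/-- Induction on the formation of primes: `C ⇒ τ` is built after the elements of `C`. -/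
theorem induct {P : Prime → Prop} (h : ∀ C : CTy, (∀ p ∈ C, P p) → P (mk C)) (p : Prime) :
    P p := by
  refine QPF.Fix.ind P (fun C hC => h C ?_) p
  obtain ⟨u, rfl⟩ := hC
  intro p hp
  obtain ⟨q, -, rfl⟩ := Multiset.mem_map.1 hp
  exact q.2

end Prime

open LamPlus.Prime

@[simp] theorem map_subArgs_map_addArgs (C D : CTy) :
    (D.map (addArgs C)).map (subArgs C) = D := by
  simp [Multiset.map_map]

theorem map_addArgs_map_subArgs {C D : CTy} (h : ∀ p ∈ D, C ≤ p.args) :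
    (D.map (subArgs C)).map (addArgs C) = D := by
  rw [Multiset.map_map]
  conv_rhs => rw [← Multiset.map_id D]
  exact Multiset.map_congr rfl fun p hp => addArgs_subArgs (h p hp)

theorem le_args_of_mem_map_addArgs {C D : CTy} {p : Prime} (hp : p ∈ D.map (addArgs C)) :
    C ≤ p.args := by
  obtain ⟨q, -, rfl⟩ := Multiset.mem_map.1 hp
  simp

theorem can_ne_zero (R : Ty) : can R ≠ 0 := by
  induction R with
  | atom => simp [can]
  | arr R S _ ihS => simpa [can] using ihS
  | conj R S ihR _ => simp [can, ihR]

theorem can_eq_of_iso {R S : Ty} (h : Ty.Iso R S) : can R = can S := by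
  induction h with
  | refl => rfl
  | symm _ ih => exact ih.symm
  | trans _ _ ih₁ ih₂ => exact ih₁.trans ih₂
  | comm => exact add_comm _ _
  | assoc => exact add_assoc _ _ _
  | dist => exact Multiset.map_add _ _ _
  | curry => simp [can, Multiset.map_map, addArgs_addArgs]
  | arr _ _ ih₁ ih₂ => simp [can, ih₁, ih₂]
  | conj _ _ ih₁ ih₂ => simp [can, ih₁, ih₂]

theorem can_conj_ne_singleton (R S : Ty) (p : Prime) : can (R.conj S) ≠ {p} := by
  intro h
  have hR := Multiset.card_pos.2 (can_ne_zero R)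
  have hS := Multiset.card_pos.2 (can_ne_zero S)
  have := congrArg Multiset.card h
  simp only [can, Multiset.card_add, Multiset.card_singleton] at this
  omega

theorem exists_can_eq_of_forall {C : CTy} (hC : C ≠ 0) (h : ∀ p ∈ C, ∃ T, can T = {p}) :
    ∃ T, can T = C := by
  induction C using Multiset.induction with
  | empty => exact absurd rfl hC
  | cons p C ih =>
    obtain ⟨T, hT⟩ := h p (Multiset.mem_cons_self p C)
    rcases eq_or_ne C 0 with rfl | hC'
    · exact ⟨T, hT⟩
    · obtain ⟨U, hU⟩ := ih hC' fun q hq => h q (Multiset.mem_cons_of_mem hq)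
      exact ⟨T.conj U, by rw [can, hT, hU, Multiset.singleton_add]⟩

theorem exists_can_eq_singleton (p : Prime) : ∃ T, can T = {p} := by
  induction p using Prime.induct with
  | h C ih =>
    rcases eq_or_ne C 0 with rfl | hC
    · exact ⟨.atom, rfl⟩
    · obtain ⟨T, rfl⟩ := exists_can_eq_of_forall hC ih
      exact ⟨.arr T .atom, by simp [can, addArgs, args_mk]⟩

theorem exists_can_eq {C : CTy} (hC : C ≠ 0) : ∃ T, can T = C :=
  exists_can_eq_of_forall hC fun p _ => exists_can_eq_singleton p

/-- A type whose canonical form has a single element `C ⇒ τ` is isomorphic to `τ` or `Q ⇒ τ`. -/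
theorem iso_of_can_eq_singleton {R : Ty} {p : Prime} (h : can R = {p}) :
    (Ty.Iso R .atom ∧ p.args = 0) ∨ ∃ Q, Ty.Iso R (.arr Q .atom) ∧ can Q = p.args := by
  induction R generalizing p with
  | atom =>
    obtain rfl : Prime.mk 0 = p := Multiset.singleton_inj.1 h
    exact .inl ⟨.refl _, args_mk 0⟩
  | arr A B _ ih =>
    obtain ⟨q, hq, rfl⟩ := Multiset.map_eq_singleton.1 h
    rcases ih hq with ⟨hB, h0⟩ | ⟨Q, hB, hQ⟩
    · exact .inr ⟨A, .arr (.refl _) hB, by simp [h0]⟩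
    · exact .inr ⟨A.conj Q, .trans (.arr (.refl _) hB) (.curry _ _ _), by simp [can, hQ]⟩
  | conj A B => exact absurd h (can_conj_ne_singleton A B p)

/-- Every element of a canonical form can be split off as a conjunct, up to isomorphism. -/
theorem exists_conj_iso_of_mem_can {R : Ty} {p : Prime} (h : p ∈ can R) :
    can R = {p} ∨ ∃ R₁ R₂, Ty.Iso R (.conj R₁ R₂) ∧ can R₁ = {p} := by
  induction R generalizing p with
  | atom => exact .inl (by rw [Multiset.mem_singleton.1 h]; rfl)
  | arr A B _ ih =>
    obtain ⟨q, hq, rfl⟩ := Multiset.mem_map.1 h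
    rcases ih hq with hB | ⟨B₁, B₂, hB, h₁⟩
    · exact .inl (by simp [can, hB])
    · exact .inr ⟨A.arr B₁, A.arr B₂, .trans (.arr (.refl _) hB) (.dist _ _ _), by simp [can, h₁]⟩
  | conj A B ihA ihB =>
    rcases Multiset.mem_add.1 h with hA | hB
    · rcases ihA hA with hA | ⟨A₁, A₂, hA, h₁⟩
      · exact .inr ⟨A, B, .refl _, hA⟩
      · exact .inr ⟨A₁, A₂.conj B, .trans (.conj hA (.refl _)) (.assoc _ _ _), h₁⟩
    · rcases ihB hB with hB | ⟨B₁, B₂, hB, h₁⟩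
      · exact .inr ⟨B, A, .comm _ _, hB⟩
      · exact .inr ⟨B₁, B₂.conj A,
          .trans (.comm _ _) (.trans (.conj hB (.refl _)) (.assoc _ _ _)), h₁⟩

theorem iso_of_can_eq_of_forall {R S : Ty} (h : can R = can S)
    (hp : ∀ p ∈ can R, ∀ T U, can T = {p} → can U = {p} → Ty.Iso T U) : Ty.Iso R S := by
  induction hn : (can R).card using Nat.strong_induction_on generalizing R S with
  | _ n ih =>
    obtain ⟨p, hpR⟩ := Multiset.exists_mem_of_ne_zero (can_ne_zero R)
    rcases exists_conj_iso_of_mem_can hpR with hR | ⟨R₁, R₂, hR, h₁⟩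
    · exact hp p hpR R S hR (h ▸ hR)
    rcases exists_conj_iso_of_mem_can (h ▸ hpR) with hS | ⟨S₁, S₂, hS, h₂⟩
    · exact hp p hpR R S (h ▸ hS) hS
    have eR : can R = {p} + can R₂ := by rw [can_eq_of_iso hR, can, h₁]
    have eS : can S = {p} + can S₂ := by rw [can_eq_of_iso hS, can, h₂]
    have e : can R₂ = can S₂ := add_left_cancel (eR.symm.trans (h.trans eS))
    refine .trans hR (.trans (.conj (hp p hpR _ _ h₁ h₂) ?_) hS.symm)
    refine ih _ ?_ e (fun q hq => hp q (by rw [eR]; exact Multiset.mem_add.2 (.inr hq))) rfl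
    rw [← hn, eR, Multiset.card_add, Multiset.card_singleton]
    omega

theorem iso_of_can_eq_singletons (p : Prime) :
    ∀ T U, can T = {p} → can U = {p} → Ty.Iso T U := by
  induction p using Prime.induct with
  | h C ih =>
    intro T U hT hU
    rcases iso_of_can_eq_singleton hT with ⟨iT, h0⟩ | ⟨Q, iT, hQ⟩ <;>
      rcases iso_of_can_eq_singleton hU with ⟨iU, h0'⟩ | ⟨Q', iU, hQ'⟩
    · exact .trans iT iU.symm
    · exact absurd (hQ'.trans h0) (can_ne_zero _)
    · exact absurd (hQ.trans h0') (can_ne_zero _)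
    · refine .trans iT (.trans (.arr ?_ (.refl _)) iU.symm)
      rw [args_mk] at hQ hQ'
      exact iso_of_can_eq_of_forall (hQ.trans hQ'.symm) fun p hp => ih p (hQ ▸ hp)

/-- Canonical forms are complete invariants for type isomorphism. -/
theorem iso_of_can_eq {R S : Ty} (h : can R = can S) : Ty.Iso R S :=
  iso_of_can_eq_of_forall h fun p _ => iso_of_can_eq_singletons p

theorem can_replace {R S : Ty} (h : Ty.Iso R S) (T : Ty) : can (Ty.replace R S T) = can T := by
  induction T with
  | atom =>
    rw [Ty.replace]
    split_ifs with e
    · rw [e, can_eq_of_iso h]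
    · rfl
  | arr T U ihT ihU =>
    rw [Ty.replace]
    split_ifs with e
    · rw [e, can_eq_of_iso h]
    · rw [can, can, ihT, ihU]
  | conj T U ihT ihU =>
    rw [Ty.replace]
    split_ifs with e
    · rw [e, can_eq_of_iso h]
    · rw [can, can, ihT, ihU]

/-! ### Terms and contexts under a change of annotations -/

namespace Tm

variable {A B D : Type}

theorem map_map (f : A → B) (g : B → D) (t : Tm A) : (t.map f).map g = t.map (g ∘ f) := by
  induction t <;> simp_all [map]

theorem map_rename (f : A → B) (ξ : ℕ → ℕ) (t : Tm A) :
    (t.rename ξ).map f = (t.map f).rename ξ := by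
  induction t generalizing ξ <;> simp_all [map, rename]

theorem map_subst (f : A → B) (σ : ℕ → Tm A) (t : Tm A) :
    (t.subst σ).map f = (t.map f).subst fun n => (σ n).map f := by
  induction t generalizing σ with
  | lam a t ih =>
    have : (fun n => (up σ n).map f) = up fun n => (σ n).map f := by
      funext n
      cases n with
      | zero => rfl
      | succ n => exact map_rename f _ _
    simp [map, subst, ih, this]
  | _ => simp_all [map, subst]

theorem map_inst (f : A → B) (r s : Tm A) : (inst r s).map f = inst (r.map f) (s.map f) := by
  rw [inst, map_subst, inst]
  congr 1
  funext n
  cases n <;> rfl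

/-- `+` is outermost in the term. -/
def IsPlus : Tm A → Prop
  | plus _ _ => True
  | _ => False

theorem AC.isPlus_iff {r s : Tm A} (h : AC r s) : r.IsPlus ↔ s.IsPlus := by
  induction h with
  | symm _ ih => exact ih.symm
  | trans _ _ ih₁ ih₂ => exact ih₁.trans ih₂
  | _ => rfl

theorem isPlus_sum (r : Tm A) {rs : List (Tm A)} (h : rs ≠ []) : (sum r rs).IsPlus := by
  induction rs generalizing r with
  | nil => exact absurd rfl h
  | cons s rs ih =>
    rcases eq_or_ne rs [] with rfl | h'
    · trivial
    · exact ih _ h'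

/-- A term over the annotations `B` that is equal up to AC to the image of `r` is itself the image
of a term equal to `r` up to AC. Both directions are proved together because of symmetry. -/
theorem AC.lift_map (f : A → B) {x y : Tm B} (h : AC x y) :
    (∀ r, r.map f = x → ∃ s, s.map f = y ∧ AC r s) ∧
      (∀ s, s.map f = y → ∃ r, r.map f = x ∧ AC s r) := by
  induction h with
  | refl r => exact ⟨fun r h => ⟨r, h, .refl r⟩, fun r h => ⟨r, h, .refl r⟩⟩
  | symm _ ih => exact ih.symm
  | trans _ _ ih₁ ih₂ =>
    constructor
    · intro r hr
      obtain ⟨s, hs, h₁⟩ := ih₁.1 r hr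
      obtain ⟨t, ht, h₂⟩ := ih₂.1 s hs
      exact ⟨t, ht, h₁.trans h₂⟩
    · intro r hr
      obtain ⟨s, hs, h₁⟩ := ih₂.2 r hr
      obtain ⟨t, ht, h₂⟩ := ih₁.2 s hs
      exact ⟨t, ht, h₁.trans h₂⟩
  | comm r s =>
    constructor <;>
    · intro t ht
      cases t <;> simp only [map, reduceCtorEq, Tm.plus.injEq] at ht
      obtain ⟨rfl, rfl⟩ := ht
      exact ⟨_, rfl, .comm _ _⟩
  | assoc r s t =>
    constructor
    · intro t ht
      rcases t with _ | _ | _ | ⟨t, v⟩ | _ <;> simp only [map, reduceCtorEq, Tm.plus.injEq] at ht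
      obtain ⟨ht, rfl⟩ := ht
      cases t <;> simp only [map, reduceCtorEq, Tm.plus.injEq] at ht
      obtain ⟨rfl, rfl⟩ := ht
      exact ⟨_, rfl, .assoc _ _ _⟩
    · intro t ht
      rcases t with _ | _ | _ | ⟨v, t⟩ | _ <;> simp only [map, reduceCtorEq, Tm.plus.injEq] at ht
      obtain ⟨rfl, ht⟩ := ht
      cases t <;> simp only [map, reduceCtorEq, Tm.plus.injEq] at ht
      obtain ⟨rfl, rfl⟩ := ht
      exact ⟨.plus (.plus _ _) _, rfl, .symm (.assoc _ _ _)⟩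
  | lam a _ ih =>
    constructor
    · intro t ht
      cases t <;> simp only [map, reduceCtorEq, Tm.lam.injEq] at ht
      obtain ⟨rfl, ht⟩ := ht
      obtain ⟨s, rfl, h⟩ := ih.1 _ ht
      exact ⟨_, rfl, .lam _ h⟩
    · intro t ht
      cases t <;> simp only [map, reduceCtorEq, Tm.lam.injEq] at ht
      obtain ⟨rfl, ht⟩ := ht
      obtain ⟨s, rfl, h⟩ := ih.2 _ ht
      exact ⟨_, rfl, .lam _ h⟩
  | app _ _ ih₁ ih₂ =>
    constructor
    · intro t ht
      cases t <;> simp only [map, reduceCtorEq, Tm.app.injEq] at ht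
      obtain ⟨s, rfl, h⟩ := ih₁.1 _ ht.1
      obtain ⟨s', rfl, h'⟩ := ih₂.1 _ ht.2
      exact ⟨_, rfl, .app h h'⟩
    · intro t ht
      cases t <;> simp only [map, reduceCtorEq, Tm.app.injEq] at ht
      obtain ⟨s, rfl, h⟩ := ih₁.2 _ ht.1
      obtain ⟨s', rfl, h'⟩ := ih₂.2 _ ht.2
      exact ⟨_, rfl, .app h h'⟩
  | plus _ _ ih₁ ih₂ =>
    constructor
    · intro t ht
      cases t <;> simp only [map, reduceCtorEq, Tm.plus.injEq] at ht
      obtain ⟨s, rfl, h⟩ := ih₁.1 _ ht.1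
      obtain ⟨s', rfl, h'⟩ := ih₂.1 _ ht.2
      exact ⟨_, rfl, .plus h h'⟩
    · intro t ht
      cases t <;> simp only [map, reduceCtorEq, Tm.plus.injEq] at ht
      obtain ⟨s, rfl, h⟩ := ih₁.2 _ ht.1
      obtain ⟨s', rfl, h'⟩ := ih₂.2 _ ht.2
      exact ⟨_, rfl, .plus h h'⟩
  | proj a _ ih =>
    constructor
    · intro t ht
      cases t <;> simp only [map, reduceCtorEq, Tm.proj.injEq] at ht
      obtain ⟨rfl, ht⟩ := ht
      obtain ⟨s, rfl, h⟩ := ih.1 _ ht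
      exact ⟨_, rfl, .proj _ h⟩
    · intro t ht
      cases t <;> simp only [map, reduceCtorEq, Tm.proj.injEq] at ht
      obtain ⟨rfl, ht⟩ := ht
      obtain ⟨s, rfl, h⟩ := ih.2 _ ht
      exact ⟨_, rfl, .proj _ h⟩

end Tm

namespace Cx

variable {A B : Type}

/-- Apply `f` to every type annotation. -/
def map (f : A → B) : Cx A → Cx B
  | hole => hole
  | lam a C => lam (f a) (map f C)
  | appL C r => appL (map f C) (r.map f)
  | appR r C => appR (r.map f) (map f C)
  | plusL C r => plusL (map f C) (r.map f)
  | plusR r C => plusR (r.map f) (map f C)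
  | proj a C => proj (f a) (map f C)

/-- The number of constructors above the hole. -/
def depth : Cx A → ℕ
  | hole => 0
  | lam _ C | appL C _ | appR _ C | plusL C _ | plusR _ C | proj _ C => depth C + 1

theorem map_plug (f : A → B) (C : Cx A) (t : Tm A) :
    (C.plug t).map f = (C.map f).plug (t.map f) := by
  induction C <;> simp_all [map, plug, Tm.map]

theorem binders_map (f : A → B) (C : Cx A) (Γ : List A) :
    (C.map f).binders (Γ.map f) = (C.binders Γ).map f := by
  induction C generalizing Γ with
  | lam a C ih => exact ih (a :: Γ)
  | _ => simp_all [map, binders]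

theorem comp_plug (C D : Cx A) (t : Tm A) : (C.comp D).plug t = C.plug (D.plug t) := by
  induction C <;> simp_all [comp, plug]

theorem comp_binders (C D : Cx A) (Γ : List A) :
    (C.comp D).binders Γ = D.binders (C.binders Γ) := by
  induction C generalizing Γ <;> simp_all [comp, binders]

theorem comp_hole (C : Cx A) : C.comp hole = C := by
  induction C <;> simp_all [comp]

theorem depth_comp (C D : Cx A) : (C.comp D).depth = C.depth + D.depth := by
  induction C <;> simp_all [comp, depth] <;> omega

theorem comp_proj_ne_hole (C D : Cx A) (a : A) : C.comp (proj a D) ≠ hole := by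
  cases C <;> simp [comp]

theorem not_inProj_hole : ¬ (hole : Cx A).InProj := fun ⟨C, a, h⟩ => comp_proj_ne_hole C _ a h.symm

theorem inProj_proj {a : A} {C : Cx A} : (proj a C).InProj ↔ C = hole ∨ C.InProj := by
  constructor
  · rintro ⟨D, b, h⟩
    cases D <;> simp only [comp, proj.injEq, reduceCtorEq] at h
    · exact .inl h.2
    · exact .inr ⟨_, b, h.2⟩
  · rintro (rfl | ⟨D, b, rfl⟩)
    · exact ⟨hole, a, rfl⟩
    · exact ⟨proj a D, b, rfl⟩

theorem inProj_lam {a : A} {C : Cx A} : (lam a C).InProj ↔ C.InProj := by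
  constructor
  · rintro ⟨D, b, h⟩
    cases D <;> simp only [comp, lam.injEq, reduceCtorEq] at h
    exact ⟨_, b, h.2⟩
  · rintro ⟨D, b, rfl⟩
    exact ⟨lam a D, b, rfl⟩

theorem inProj_appL {r : Tm A} {C : Cx A} : (appL C r).InProj ↔ C.InProj := by
  constructor
  · rintro ⟨D, b, h⟩
    cases D <;> simp only [comp, appL.injEq, reduceCtorEq] at h
    exact ⟨_, b, h.1⟩
  · rintro ⟨D, b, rfl⟩
    exact ⟨appL D r, b, rfl⟩

theorem inProj_appR {r : Tm A} {C : Cx A} : (appR r C).InProj ↔ C.InProj := by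
  constructor
  · rintro ⟨D, b, h⟩
    cases D <;> simp only [comp, appR.injEq, reduceCtorEq] at h
    exact ⟨_, b, h.2⟩
  · rintro ⟨D, b, rfl⟩
    exact ⟨appR r D, b, rfl⟩

theorem inProj_plusL {r : Tm A} {C : Cx A} : (plusL C r).InProj ↔ C.InProj := by
  constructor
  · rintro ⟨D, b, h⟩
    cases D <;> simp only [comp, plusL.injEq, reduceCtorEq] at h
    exact ⟨_, b, h.1⟩
  · rintro ⟨D, b, rfl⟩
    exact ⟨plusL D r, b, rfl⟩

theorem inProj_plusR {r : Tm A} {C : Cx A} : (plusR r C).InProj ↔ C.InProj := by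
  constructor
  · rintro ⟨D, b, h⟩
    cases D <;> simp only [comp, plusR.injEq, reduceCtorEq] at h
    exact ⟨_, b, h.2⟩
  · rintro ⟨D, b, rfl⟩
    exact ⟨plusR r D, b, rfl⟩

theorem map_eq_hole {f : A → B} {C : Cx A} : C.map f = hole ↔ C = hole := by
  cases C <;> simp [map]

theorem inProj_map {f : A → B} {C : Cx A} : (C.map f).InProj ↔ C.InProj := by
  induction C with
  | hole => simp [map, not_inProj_hole]
  | _ => simp_all [map, map_eq_hole, inProj_proj, inProj_lam, inProj_appL, inProj_appR,
      inProj_plusL, inProj_plusR]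

theorem comp_eq_hole {C D : Cx A} : C.comp D = hole ↔ C = hole ∧ D = hole := by
  cases C <;> simp [comp]

/-- Whether the hole stands directly under a projection depends on the inner context only, if that
one is not trivial. -/
theorem inProj_comp {C D : Cx A} (hD : D ≠ hole) : (C.comp D).InProj ↔ D.InProj := by
  induction C with
  | hole => rfl
  | _ => simp_all [comp, comp_eq_hole, inProj_proj, inProj_lam, inProj_appL, inProj_appR,
      inProj_plusL, inProj_plusR]

end Cx

/-! ### Typing in the two calculi -/

theorem ITyped.canTm_of_typed {Γ : List Ty} {r : Tm Ty} {R : Ty} (h : Typed Γ r R) :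
    ITyped (Γ.map can) (canTm r) (can R) := by
  induction h with
  | ax h => exact .ax (by simp [h])
  | iso hi _ ih => exact can_eq_of_iso hi ▸ ih
  | arrI _ ih => exact .arrI (can_ne_zero _) ih
  | @arrE Γ r s R S _ _ ih₁ ih₂ =>
    have := ITyped.arrE ih₁ ih₂ fun p hp => le_args_of_mem_map_addArgs hp
    rwa [can, map_subArgs_map_addArgs] at this
  | conjI _ _ ih₁ ih₂ => exact .conjI ih₁ ih₂
  | conjEn _ ih => exact .conjE ih (can_ne_zero _) (by simp [can])
  | conjE1 _ ih => exact .conjE ih (can_ne_zero _) le_rfl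

/-- The translation reflects typing. -/
theorem ITyped.exists_typed {Γ : List Ty} {r : Tm Ty} {C : CTy}
    (h : ITyped (Γ.map can) (canTm r) C) : ∃ R, can R = C ∧ Typed Γ r R := by
  induction r generalizing Γ C with
  | var n =>
    cases h with
    | ax h =>
      rw [List.getElem?_map, Option.map_eq_some_iff] at h
      obtain ⟨R, hR, rfl⟩ := h
      exact ⟨R, rfl, .ax hR⟩
  | lam a t ih =>
    cases h with
    | arrI _ h =>
      obtain ⟨R, rfl, hR⟩ := ih (Γ := a :: Γ) h
      exact ⟨.arr a R, rfl, .arrI hR⟩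
  | app r s ihr ihs =>
    cases h with
    | arrE hr hs hle =>
      obtain ⟨T, rfl, hT⟩ := ihr hr
      obtain ⟨S, rfl, hS⟩ := ihs hs
      obtain ⟨R, hR⟩ := exists_can_eq (C := (can T).map (subArgs (can S)))
        (by simpa using can_ne_zero T)
      refine ⟨R, hR, .arrE (.iso (iso_of_can_eq ?_) hT) hS⟩
      rw [can, hR, map_addArgs_map_subArgs hle]
  | plus r s ihr ihs =>
    cases h with
    | conjI hr hs =>
      obtain ⟨R, rfl, hR⟩ := ihr hr
      obtain ⟨S, rfl, hS⟩ := ihs hs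
      exact ⟨.conj R S, rfl, .conjI hR hS⟩
  | proj a t ih =>
    cases h with
    | conjE h _ hle =>
      obtain ⟨T, rfl, hT⟩ := ih h
      refine ⟨a, rfl, ?_⟩
      rcases eq_or_ne (can T - can a) 0 with h0 | h0
      · exact .conjE1 (.iso (iso_of_can_eq (le_antisymm (tsub_eq_zero_iff_le.1 h0) hle)) hT)
      · obtain ⟨U, hU⟩ := exists_can_eq h0
        refine .conjEn (R' := U) (.iso (iso_of_can_eq ?_) hT)
        rw [can, hU, add_tsub_cancel_of_le hle]

theorem ITyped.typed {Γ : List Ty} {r : Tm Ty} {R : Ty}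
    (h : ITyped (Γ.map can) (canTm r) (can R)) : Typed Γ r R :=
  let ⟨_, hS, h⟩ := h.exists_typed
  .iso (iso_of_can_eq hS) h

theorem ITyped.lam_inv {Γ : List CTy} {C E : CTy} {r : Tm CTy} (h : ITyped Γ (.lam C r) E) :
    C ≠ 0 ∧ ∃ D, ITyped (C :: Γ) r D ∧ E = D.map (addArgs C) := by
  cases h with
  | arrI h0 h => exact ⟨h0, _, h, rfl⟩

theorem ITyped.plus_inv {Γ : List CTy} {E : CTy} {r s : Tm CTy} (h : ITyped Γ (.plus r s) E) :
    ∃ C D, ITyped Γ r C ∧ ITyped Γ s D ∧ E = C + D := by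
  cases h with
  | conjI hr hs => exact ⟨_, _, hr, hs, rfl⟩

theorem ITyped.proj_inv {Γ : List CTy} {D E : CTy} {r : Tm CTy} (h : ITyped Γ (.proj D r) E) :
    E = D ∧ D ≠ 0 ∧ ∃ C, ITyped Γ r C ∧ D ≤ C := by
  cases h with
  | conjE h h0 hle => exact ⟨rfl, h0, _, h, hle⟩

/-- In a typed term, every subterm has a type, and can be replaced by any term of that type. -/
theorem ITyped.plug_inv {K : Cx CTy} {Γ : List CTy} {t : Tm CTy} {U : CTy}
    (h : ITyped Γ (K.plug t) U) :
    ∃ V, ITyped (K.binders Γ) t V ∧ ∀ t', ITyped (K.binders Γ) t' V → ITyped Γ (K.plug t') U := by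
  induction K generalizing Γ U with
  | hole => exact ⟨U, h, fun _ h => h⟩
  | lam a K ih =>
    cases h with
    | arrI h0 h =>
      obtain ⟨V, hV, h⟩ := ih h
      exact ⟨V, hV, fun t' ht => .arrI h0 (h t' ht)⟩
  | appL K r ih =>
    cases h with
    | arrE h h' hle =>
      obtain ⟨V, hV, h⟩ := ih h
      exact ⟨V, hV, fun t' ht => .arrE (h t' ht) h' hle⟩
  | appR r K ih =>
    cases h with
    | arrE h h' hle =>
      obtain ⟨V, hV, h'⟩ := ih h'
      exact ⟨V, hV, fun t' ht => .arrE h (h' t' ht) hle⟩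
  | plusL K r ih =>
    cases h with
    | conjI h h' =>
      obtain ⟨V, hV, h⟩ := ih h
      exact ⟨V, hV, fun t' ht => .conjI (h t' ht) h'⟩
  | plusR r K ih =>
    cases h with
    | conjI h h' =>
      obtain ⟨V, hV, h'⟩ := ih h'
      exact ⟨V, hV, fun t' ht => .conjI h (h' t' ht)⟩
  | proj a K ih =>
    cases h with
    | conjE h h0 hle =>
      obtain ⟨V, hV, h⟩ := ih h
      exact ⟨V, hV, fun t' ht => .conjE (h t' ht) h0 hle⟩

/-! ### Rewriting in the implementation -/

/-- `r →* s` on representatives, by steps of either label. -/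
def IRw (Γ : List CTy) : Tm CTy → Tm CTy → Prop :=
  Relation.ReflTransGen fun r s => ∃ ℓ, IStepL ℓ Γ r s

/-- `r →* s` on representatives without (δ): a relation that is closed under all contexts. -/
def IRwN (Γ : List CTy) : Tm CTy → Tm CTy → Prop :=
  Relation.ReflTransGen (IStepL .notDelta Γ)

theorem IRwN.of_ax {Γ : List CTy} {r s : Tm CTy} (h : IAx .notDelta Γ r s) : IRwN Γ r s :=
  .single (.ax h)

theorem IRwN.trans {Γ : List CTy} {r s t : Tm CTy} (h : IRwN Γ r s) (h' : IRwN Γ s t) :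
    IRwN Γ r t :=
  Relation.ReflTransGen.trans h h'

theorem IRwN.plug {K : Cx CTy} {Γ : List CTy} {r s : Tm CTy} (h : IRwN (K.binders Γ) r s) :
    IRwN Γ (K.plug r) (K.plug s) :=
  Relation.ReflTransGen.lift K.plug (fun _ _ h => IStepL.ctxNotDelta K h) _ _ h

theorem IRwN.lam {Γ : List CTy} {C : CTy} {r s : Tm CTy} (h : IRwN (C :: Γ) r s) :
    IRwN Γ (.lam C r) (.lam C s) :=
  IRwN.plug (K := .lam C .hole) h

theorem IRwN.plus {Γ : List CTy} {r r' s s' : Tm CTy} (h : IRwN Γ r r') (h' : IRwN Γ s s') :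
    IRwN Γ (.plus r s) (.plus r' s') :=
  .trans (IRwN.plug (K := .plusL .hole s) h) (IRwN.plug (K := .plusR r' .hole) h')

theorem IRwN.proj_plus_left {Γ : List CTy} {C D : CTy} {r : Tm CTy} (s : Tm CTy)
    (h : ITyped Γ r D) (hle : C ≤ D) : IRwN Γ (.proj C (.plus r s)) (.proj C r) :=
  .of_ax (.simp s h hle)

theorem IRwN.proj_plus_right {Γ : List CTy} {C D : CTy} (r : Tm CTy) {s : Tm CTy}
    (h : ITyped Γ s D) (hle : C ≤ D) : IRwN Γ (.proj C (.plus r s)) (.proj C s) :=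
  .single (.ac (.proj C (.comm r s)) (.ax (.simp r h hle)) (.refl _))

theorem IRwN.proj_lam (Γ : List CTy) (C D : CTy) (r : Tm CTy) :
    IRwN Γ (.proj (D.map (addArgs C)) (.lam C r)) (.lam C (.proj D r)) := by
  have := IAx.commEI Γ (C := D.map (addArgs C)) r fun p hp => le_args_of_mem_map_addArgs hp
  rw [map_subArgs_map_addArgs] at this
  exact .of_ax this

theorem IRwN.toIRw {Γ : List CTy} {r s : Tm CTy} (h : IRwN Γ r s) : IRw Γ r s :=
  Relation.ReflTransGen.mono (fun _ _ h => ⟨_, h⟩) _ _ h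

theorem IRw.appL {Γ : List CTy} {r r' : Tm CTy} (s : Tm CTy) (h : IRw Γ r r') :
    IRw Γ (.app r s) (.app r' s) := by
  refine Relation.ReflTransGen.lift (fun t => Tm.app t s) ?_ _ _ h
  rintro a b ⟨_ | _, h⟩
  · exact ⟨_, IStepL.ctxNotDelta (.appL .hole s) h⟩
  · exact ⟨_, IStepL.ctxDelta (.appL .hole s) h
      fun h => Cx.not_inProj_hole (Cx.inProj_appL.1 h)⟩

theorem IRw.toITm {Γ : List CTy} {r s : Tm CTy} (h : IRw Γ r s) :
    Relation.ReflTransGen (IStep Γ) (ITm.of r) (ITm.of s) :=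
  Relation.ReflTransGen.lift ITm.of (fun r s ⟨ℓ, h⟩ => ⟨ℓ, r, s, rfl, rfl, h⟩) _ _ h

theorem joinable_of_iRw {r s t : Tm CTy} (hr : IRw [] r t) (hs : IRw [] s t) :
    Joinable (ITm.of r) (ITm.of s) :=
  ⟨ITm.of t, hr.toITm, hs.toITm⟩

/-! ### Abstractions over sums -/

/-- Where (δ) is allowed, it distributes an abstraction over a sum: the two projections that it
creates move under the abstraction, and each of them selects one summand. -/
theorem iRw_lam_plus {K : Cx CTy} (hK : ¬ K.InProj) {Γ : List CTy} {C D E : CTy} {a b : Tm CTy}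
    (hC : C ≠ 0) (hD : D ≠ 0) (hE : E ≠ 0) (ha : ITyped (C :: K.binders Γ) a D)
    (hb : ITyped (C :: K.binders Γ) b E) :
    IRw Γ (K.plug (.lam C (.plus a b))) (K.plug (.plus (.lam C a) (.lam C b))) := by
  have hδ : IAx .delta (K.binders Γ) (.lam C (.plus a b))
      (.plus (.proj (D.map (addArgs C)) (.lam C (.plus a b)))
        (.proj (E.map (addArgs C)) (.lam C (.plus a b)))) := by
    refine IAx.delta (Cs := [E.map (addArgs C)]) (by simp) (by simp [hD, hE]) ?_ ?_
    · simpa using ITyped.arrI hC (ITyped.conjI ha hb)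
    · rintro ⟨u, us, hAC, h⟩
      refine (hAC.isPlus_iff.2 (Tm.isPlus_sum u ?_)).elim
      rintro rfl
      simpa using h.length_eq
  refine .head ⟨_, .ctxDelta K (.ax hδ) hK⟩ (IRwN.toIRw (IRwN.plug (IRwN.plus ?_ ?_)))
  · exact (IRwN.proj_lam _ C D _).trans
      (.lam ((IRwN.proj_plus_left b ha le_rfl).trans (.of_ax (.proj ha))))
  · exact (IRwN.proj_lam _ C E _).trans
      (.lam ((IRwN.proj_plus_right a hb le_rfl).trans (.of_ax (.proj hb))))

/-- Directly under a projection, where (δ) is not allowed, the projection moves inwards on both sides.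
It either deletes one summand, or both terms become an abstraction over a sum and its distributed
form again, one projection closer to the root. -/
theorem exists_iRw_iRw_lam_plus {K : Cx CTy} {Γ : List CTy} {C D E U : CTy} {a b : Tm CTy}
    (hC : C ≠ 0) (hD : D ≠ 0) (hE : E ≠ 0) (ha : ITyped (C :: K.binders Γ) a D)
    (hb : ITyped (C :: K.binders Γ) b E)
    (h : ITyped Γ (K.plug (.plus (.lam C a) (.lam C b))) U) :
    ∃ t, IRw Γ (K.plug (.lam C (.plus a b))) t ∧
      IRw Γ (K.plug (.plus (.lam C a) (.lam C b))) t := by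
  by_cases hK : K.InProj
  swap
  · exact ⟨_, iRw_lam_plus hK hC hD hE ha hb, .refl⟩
  obtain ⟨K, T, rfl⟩ := hK
  simp only [Cx.comp_binders, Cx.binders] at ha hb
  simp only [Cx.comp_plug, Cx.plug] at h ⊢
  obtain ⟨V, hV, hrepl⟩ := h.plug_inv
  obtain ⟨rfl, hT0, W, hW, hTW⟩ := hV.proj_inv
  obtain ⟨_, _, hla, hlb, rfl⟩ := hW.plus_inv
  obtain ⟨-, D', ha', rfl⟩ := hla.lam_inv
  obtain ⟨-, E', hb', rfl⟩ := hlb.lam_inv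
  -- `V = C ⇒ (X ⊎ Y)`, where `X` is selected from the type of `a` and `Y` from that of `b`
  obtain ⟨X, Y, hX, hY, rfl⟩ :
      ∃ X Y, X ≤ D' ∧ Y ≤ E' ∧ V = (X + Y).map (addArgs C) := by
    rw [← Multiset.map_add] at hTW
    have hle : V.map (subArgs C) ≤ D' + E' := by
      simpa only [map_subArgs_map_addArgs] using Multiset.map_le_map (f := subArgs C) hTW
    refine ⟨V.map (subArgs C) ∩ D', V.map (subArgs C) - D', Multiset.inter_le_right,
      tsub_le_iff_left.2 hle, ?_⟩
    rw [add_comm, Multiset.sub_add_inter, map_addArgs_map_subArgs]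
    exact fun p hp => le_args_of_mem_map_addArgs (Multiset.mem_of_le hTW hp)
  have hlam := IRwN.proj_lam (K.binders Γ) C (X + Y) (.plus a b)
  have hXa := IRwN.proj_lam (K.binders Γ) C X a
  have hYb := IRwN.proj_lam (K.binders Γ) C Y b
  have hX' := Multiset.map_le_map (f := addArgs C) hX
  have hY' := Multiset.map_le_map (f := addArgs C) hY
  rcases eq_or_ne X 0 with rfl | hX0
  · rw [zero_add] at *
    exact ⟨_, (IRwN.plug (hlam.trans (.lam (.proj_plus_right a hb' hY)))).toIRw,
      (IRwN.plug ((IRwN.proj_plus_right _ hlb hY').trans hYb)).toIRw⟩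
  rcases eq_or_ne Y 0 with rfl | hY0
  · rw [add_zero] at *
    exact ⟨_, (IRwN.plug (hlam.trans (.lam (.proj_plus_left b ha' hX)))).toIRw,
      (IRwN.plug ((IRwN.proj_plus_left _ hla hX').trans hXa)).toIRw⟩
  have hpa := ITyped.conjE ha' hX0 hX
  have hpb := ITyped.conjE hb' hY0 hY
  have htyped := ITyped.conjI (.arrI hC hpa) (.arrI hC hpb)
  rw [← Multiset.map_add] at htyped
  obtain ⟨t, h₁, h₂⟩ := exists_iRw_iRw_lam_plus hC hX0 hY0 hpa hpb (hrepl _ htyped)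
  refine ⟨t, .trans (IRwN.plug (hlam.trans
      (.lam (.of_ax (.distE hX0 hY0 ha' hb' hX hY))))).toIRw h₁,
    .trans (IRwN.plug (.trans ?_ (.plus hXa hYb))).toIRw h₂⟩
  rw [Multiset.map_add]
  exact .of_ax (.distE (by simpa using hX0) (by simpa using hY0) hla hlb hX' hY')
termination_by K.depth
decreasing_by subst_vars; simp [Cx.depth_comp, Cx.depth]

/-! ### Translating the relation `⇄` -/

theorem Eqv.exists_ax {ρ : EqRule} {Γ : List Ty} {r s : Tm Ty} (h : Eqv ρ Γ r s) :
    ∃ (K : Cx Ty) (r₀ s₀ : Tm Ty), r = K.plug r₀ ∧ s = K.plug s₀ ∧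
      (EqAx ρ (K.binders Γ) r₀ s₀ ∨ EqAx ρ (K.binders Γ) s₀ r₀) := by
  induction h with
  | ax h => exact ⟨.hole, _, _, rfl, rfl, .inl h⟩
  | symm _ ih =>
    obtain ⟨K, r₀, s₀, rfl, rfl, h⟩ := ih
    exact ⟨K, s₀, r₀, rfl, rfl, h.symm⟩
  | ctx C _ ih =>
    obtain ⟨K, r₀, s₀, rfl, rfl, h⟩ := ih
    exact ⟨C.comp K, r₀, s₀, (Cx.comp_plug ..).symm, (Cx.comp_plug ..).symm,
      by rwa [Cx.comp_binders]⟩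

/-- The rules of `⇄` other than (comm), (asso) and (distII) are rules of the implementation,
read in one of the two directions. -/
theorem EqAx.iRwN_or {ρ : EqRule} {Γ : List Ty} {r s : Tm Ty} (h : EqAx ρ Γ r s)
    (hc : ρ ≠ .comm) (ha : ρ ≠ .asso) (hd : ρ ≠ .distII) :
    IRwN (Γ.map can) (canTm r) (canTm s) ∨ IRwN (Γ.map can) (canTm s) (canTm r) := by
  cases h with
  | comm => exact absurd rfl hc
  | asso => exact absurd rfl ha
  | distII => exact absurd rfl hd
  | distIE _ r s t => exact .inl (.of_ax (.distI _ (canTm r) [canTm s] (canTm t) (by simp)))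
  | distEI _ R S r => exact .inl (IRwN.proj_lam _ (can R) (can S) (canTm r))
  | distEE hr hs => exact .inr (.of_ax (.commEE _ (.canTm_of_typed hs)))
  | curry _ r s t => exact .inr (.of_ax (.curry _ (canTm r) (canTm s) [canTm t] (by simp)))
  | subst _ r h =>
    refine .inl ?_
    have : can ∘ Ty.replace _ _ = can := funext (can_replace h)
    rw [canTm, canTm, Tm.map_map, this]
    exact .refl
  | @split _ R R' S S' r s hr hs =>
    have key : ∀ {T T' : Ty} {t : Tm Ty}, Typed Γ t (T.conj T') ∨ Typed Γ t T →
        ∃ C, ITyped (Γ.map can) (canTm t) C ∧ can T ≤ C := by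
      rintro T T' t (h | h)
      · exact ⟨_, .canTm_of_typed h, Multiset.le_add_right _ _⟩
      · exact ⟨_, .canTm_of_typed h, le_rfl⟩
    obtain ⟨C, hC, hRC⟩ := key hr
    obtain ⟨D, hD, hSD⟩ := key hs
    exact .inl (.of_ax (.distE (can_ne_zero R) (can_ne_zero S) hC hD hRC hSD))

theorem exists_iRw_of_typed_plug {K : Cx Ty} {Γ : List Ty} {R T : Ty} {a b : Tm Ty}
    (h : Typed Γ (K.plug (.plus (.lam R a) (.lam R b))) T) :
    ∃ t, IRw (Γ.map can) (canTm (K.plug (.lam R (.plus a b)))) t ∧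
      IRw (Γ.map can) (canTm (K.plug (.plus (.lam R a) (.lam R b)))) t := by
  have h := ITyped.canTm_of_typed h
  simp only [canTm, Cx.map_plug, Tm.map] at h ⊢
  obtain ⟨V, hV, -⟩ := h.plug_inv
  obtain ⟨_, _, hla, hlb, -⟩ := hV.plus_inv
  obtain ⟨hR, D, ha, -⟩ := hla.lam_inv
  obtain ⟨-, E, hb, -⟩ := hlb.lam_inv
  refine exists_iRw_iRw_lam_plus hR ?_ ?_ ha hb h
  · rw [Cx.binders_map, ← List.map_cons] at ha
    obtain ⟨R, rfl, -⟩ := ha.exists_typed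
    exact can_ne_zero R
  · rw [Cx.binders_map, ← List.map_cons] at hb
    obtain ⟨R, rfl, -⟩ := hb.exists_typed
    exact can_ne_zero R

theorem Typed.plug_distII {K : Cx Ty} {Γ : List Ty} {R T : Ty} {a b : Tm Ty}
    (h : Typed Γ (K.plug (.lam R (.plus a b))) T) :
    Typed Γ (K.plug (.plus (.lam R a) (.lam R b))) T := by
  apply ITyped.typed
  have h := ITyped.canTm_of_typed h
  simp only [canTm, Cx.map_plug, Tm.map] at h ⊢
  obtain ⟨V, hV, hrepl⟩ := h.plug_inv
  apply hrepl
  obtain ⟨hR, _, hab, rfl⟩ := hV.lam_inv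
  obtain ⟨D, E, ha, hb, rfl⟩ := hab.plus_inv
  exact Multiset.map_add _ D E ▸ .conjI (.arrI hR ha) (.arrI hR hb)

theorem Eqv.exists_iRw {ρ : EqRule} {Γ : List Ty} {r s : Tm Ty} {T : Ty} (h : Eqv ρ Γ r s)
    (hc : ρ ≠ .comm) (ha : ρ ≠ .asso) (hr : Typed Γ r T) :
    ∃ t, IRw (Γ.map can) (canTm r) t ∧ IRw (Γ.map can) (canTm s) t := by
  obtain ⟨K, r₀, s₀, rfl, rfl, hax⟩ := h.exists_ax
  by_cases hd : ρ = .distII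
  · subst hd
    rcases hax with hax | hax
    · cases hax
      exact exists_iRw_of_typed_plug hr.plug_distII
    · cases hax
      obtain ⟨t, h₁, h₂⟩ := exists_iRw_of_typed_plug hr
      exact ⟨t, h₂, h₁⟩
  · have h : IRwN ((K.binders Γ).map can) (canTm r₀) (canTm s₀) ∨
        IRwN ((K.binders Γ).map can) (canTm s₀) (canTm r₀) := by
      rcases hax with h | h
      · exact h.iRwN_or hc ha hd
      · exact (h.iRwN_or hc ha hd).symm
    rw [← Cx.binders_map] at h
    simp only [canTm, Cx.map_plug] at h ⊢
    rcases h with h | h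
    · exact ⟨_, h.plug.toIRw, .refl⟩
    · exact ⟨_, .refl, h.plug.toIRw⟩

/-! ### Translating the reduction `↪` -/

theorem EqvStar.ctx {Γ : List Ty} (K : Cx Ty) {r s : Tm Ty} (h : EqvStar (K.binders Γ) r s) :
    EqvStar Γ (K.plug r) (K.plug s) :=
  Relation.ReflTransGen.lift K.plug (fun _ _ ⟨ρ, h⟩ => ⟨ρ, .ctx K h⟩) _ _ h

theorem EqvStar.symm {Γ : List Ty} {r s : Tm Ty} (h : EqvStar Γ r s) : EqvStar Γ s r := by
  induction h with
  | refl => exact .refl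
  | tail _ h ih => exact .head ⟨h.choose, h.choose_spec.symm⟩ ih

theorem EqvStar.of_AC {r s : Tm Ty} (h : Tm.AC r s) (Γ : List Ty) : EqvStar Γ r s := by
  induction h generalizing Γ with
  | refl => exact .refl
  | symm _ ih => exact (ih Γ).symm
  | trans _ _ ih₁ ih₂ => exact .trans (ih₁ Γ) (ih₂ Γ)
  | comm r s => exact .single ⟨_, .ax (.comm Γ r s)⟩
  | assoc r s t => exact .single ⟨_, .ax (.asso Γ r s t)⟩
  | lam a _ ih => exact EqvStar.ctx (.lam a .hole) (ih (a :: Γ))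
  | @app r r' s s' _ _ ih₁ ih₂ =>
    exact .trans (EqvStar.ctx (.appL .hole s) (ih₁ Γ)) (EqvStar.ctx (.appR r' .hole) (ih₂ Γ))
  | @plus r r' s s' _ _ ih₁ ih₂ =>
    exact .trans (EqvStar.ctx (.plusL .hole s) (ih₁ Γ)) (EqvStar.ctx (.plusR r' .hole) (ih₂ Γ))
  | proj a _ ih => exact EqvStar.ctx (.proj a .hole) (ih Γ)

/-- The redex of a reduction step and its context. For (δ) the redex is typable, so that its context
would be blocked if its hole stood directly under a projection. -/
theorem RedL.exists_ax {ℓ : Lab} {Γ : List Ty} {r s : Tm Ty} (h : RedL ℓ Γ r s) :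
    ∃ (K : Cx Ty) (r₀ s₀ : Tm Ty), r = K.plug r₀ ∧ s = K.plug s₀ ∧
      RedAx ℓ (K.binders Γ) r₀ s₀ ∧ (ℓ = .delta → ¬ K.InProj) := by
  induction h with
  | ax h => exact ⟨.hole, _, _, rfl, rfl, h, fun _ => Cx.not_inProj_hole⟩
  | ctxNotDelta C _ ih =>
    obtain ⟨K, r₀, s₀, rfl, rfl, h, -⟩ := ih
    exact ⟨C.comp K, r₀, s₀, (Cx.comp_plug ..).symm, (Cx.comp_plug ..).symm,
      by rwa [Cx.comp_binders], nofun⟩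
  | ctxDelta C _ hB ih =>
    obtain ⟨K, r₀, s₀, rfl, rfl, h, hK⟩ := ih
    refine ⟨C.comp K, r₀, s₀, (Cx.comp_plug ..).symm, (Cx.comp_plug ..).symm,
      by rwa [Cx.comp_binders], fun _ => ?_⟩
    by_cases hh : K = .hole
    · subst hh
      rw [Cx.comp_hole]
      cases h with
      | delta hT _ => exact fun hC => hB ⟨_, C, hT, .refl, hC⟩
    · rw [Cx.inProj_comp hh]
      exact hK rfl

theorem RedAx.transGen_of_notDelta {Γ : List Ty} {r s : Tm Ty} (h : RedAx .notDelta Γ r s) :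
    Relation.TransGen (IStepL .notDelta (Γ.map can)) (canTm r) (canTm s) := by
  cases h with
  | beta r hs =>
    rw [canTm, canTm, Tm.map_inst]
    exact .single (.ax (.beta _ (.canTm_of_typed hs)))
  | projN t hr =>
    have h := ITyped.canTm_of_typed hr
    exact .tail (.single (.ax (.simp (canTm t) h le_rfl))) (.ax (.proj h))
  | proj1 hr => exact .single (.ax (.proj (.canTm_of_typed hr)))

/-- The side condition of (δ) carries over: a decomposition of the translated term lifts to one of
the term up to AC, and the types of its parts are reflected. -/
theorem RedAx.iAx_of_delta {Γ : List Ty} {r s : Tm Ty} (h : RedAx .delta Γ r s) :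
    IAx .delta (Γ.map can) (canTm r) (canTm s) := by
  cases h with
  | @delta _ R S _ hr hn =>
    refine IAx.delta (Cs := [can S]) (by simp) (by simp [can_ne_zero]) ?_ ?_
    · simpa [can] using ITyped.canTm_of_typed hr
    · rintro ⟨u, us, hAC, hus⟩
      obtain ⟨hu, hus⟩ := List.forall₂_cons.1 hus
      obtain ⟨v, _, hv, hnil, rfl⟩ := List.forall₂_cons_right_iff.1 hus
      obtain rfl := List.forall₂_nil_right_iff.1 hnil
      obtain ⟨t, ht, hrt⟩ := (hAC.lift_map can).1 r rfl
      cases t <;> simp only [Tm.map, Tm.sum, List.foldl, reduceCtorEq, Tm.plus.injEq] at ht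
      obtain ⟨rfl, rfl⟩ := ht
      exact hn ⟨_, _, .of_AC hrt Γ, hu.typed, hv.typed⟩

theorem RedL.transGen {ℓ : Lab} {Γ : List Ty} {r s : Tm Ty} (h : RedL ℓ Γ r s) :
    Relation.TransGen (IStepL ℓ (Γ.map can)) (canTm r) (canTm s) := by
  obtain ⟨K, r₀, s₀, rfl, rfl, h, hK⟩ := h.exists_ax
  simp only [canTm, Cx.map_plug]
  cases ℓ with
  | notDelta =>
    have := h.transGen_of_notDelta
    rw [← Cx.binders_map] at this
    exact Relation.TransGen.lift (K.map can).plug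
      (fun _ _ h => IStepL.ctxNotDelta (K.map can) h) _ _ this
  | delta =>
    have := h.iAx_of_delta
    rw [← Cx.binders_map] at this
    exact .single (.ctxDelta (K.map can) (.ax this) (mt Cx.inProj_map.1 (hK rfl)))

end LamPlus

theorem mainTheorem2 (r r' : LamPlus.Tm LamPlus.Ty) (hr : r.Closed) :
    (∀ ρ : LamPlus.EqRule, ρ ≠ LamPlus.EqRule.comm → ρ ≠ LamPlus.EqRule.asso →
      LamPlus.Eqv ρ [] r r' →
      (∀ R S : LamPlus.Ty, LamPlus.Typed [] r (LamPlus.Ty.arr R S) →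
        ∀ s : LamPlus.Tm LamPlus.CTy, LamPlus.ITyped [] s (LamPlus.can R) →
          LamPlus.Joinable (LamPlus.ITm.of (LamPlus.Tm.app (LamPlus.canTm r) s))
            (LamPlus.ITm.of (LamPlus.Tm.app (LamPlus.canTm r') s))) ∧
      ((∃ T : LamPlus.Ty, LamPlus.Typed [] r T) →
        (¬ ∃ R S : LamPlus.Ty, LamPlus.Typed [] r (LamPlus.Ty.arr R S)) →
          LamPlus.Joinable (LamPlus.ITm.of (LamPlus.canTm r))
            (LamPlus.ITm.of (LamPlus.canTm r')))) ∧
    (LamPlus.Red [] r r' →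
      Relation.TransGen (LamPlus.IStep []) (LamPlus.ITm.of (LamPlus.canTm r))
        (LamPlus.ITm.of (LamPlus.canTm r'))) := by
  refine ⟨fun ρ hc ha h => ⟨fun R S hT s _ => ?_, fun ⟨T, hT⟩ _ => ?_⟩, fun ⟨ℓ, h⟩ => ?_⟩
  · obtain ⟨t, h₁, h₂⟩ := h.exists_iRw hc ha hT
    exact LamPlus.joinable_of_iRw (h₁.appL s) (h₂.appL s)
  · obtain ⟨t, h₁, h₂⟩ := h.exists_iRw hc ha hT
    exact LamPlus.joinable_of_iRw h₁ h₂
  · exact Relation.TransGen.lift LamPlus.ITm.of (fun a b h => ⟨ℓ, a, b, rfl, rfl, h⟩) _ _ h.transGen
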